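/- Let $n\ge 2$. A domain is a nonempty connected, open, proper subset of $\mathbb{R}^n$; for a domain $\Omega$ write $\rho(x)=d(x,\partial\Omega)$, and write $|A|$ for Lebesgue measure and $B(z,r)$ for the open ball. A domain $\Omega$ is a *John domain* if it is bounded and there are $x_J\in\Omega$ and $C_J>0$ such that every $x\in\Omega$ can be joined to $x_J$ by a curve $\gamma:[0,l]\to\Omega$ parametrised by arclength with $\gamma(0)=x$, $\gamma(l)=x_J$ and $\rho(\gamma(t))\ge C_J t$ for all $t\in[0,l]$. Let $x_0\in\Omega$ and $C_s\ge 1$. A *separation curve* from $x\in\Omega$ is a continuous curve $\gamma:[0,1]\to\Omega$ with $\gamma(0)=x$, $\gamma(1)=x_0$ such that for each $t\in[0,1]$, with $B=B(\gamma(t),C_s\rho(\gamma(t)))$, either (a) $\gamma([0,t])\subset B$, or (b) no point of $\gamma([0,t])\setminus B$ lies in the same component of $\Omega\setminus\partial B$ as $x_0$. If (b) holds and (a) fails, $B$ is called a *separating ball* (of $\gamma$), and its *$B$-end* $E_B$ is the union of the components of $\Omega\setminus B$ not containing $x_0$. The domain $\Omega$ has the *separation property* (with distinguished point $x_0$ and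 constant $C_s$) if there is a separation curve from every $x\in\Omega$. **Theorem.** Let $\Omega\subset\mathbb{R}^n$ be a domain having the separation property with distinguished point $x_0$ and constant $C_s$. Then $\Omega$ is a John domain if and only if there is a constant $C_E>0$ such that $$|E_B|\le C_E|B|$$ for every separating ball $B$ (of any separation curve). Moreover, it is equivalent that there is a constant $C_E>0$ such that from each $x\in\Omega$ there is at least one separation curve all of whose separating balls satisfy $|E_B|\le C_E|B|$. -/

import Mathlib

open Set MeasureTheory

namespace SepJohn

/-- Euclidean `n`-space. -/
abbrev Rn (n : ℕ) : Type := EuclideanSpace ℝ (Fin n)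

/-- A domain: a (nonempty) connected, open and proper subset of `ℝⁿ`. -/
def IsProperDomain {n : ℕ} (Ω : Set (Rn n)) : Prop :=
  IsOpen Ω ∧ IsConnected Ω ∧ Ω ≠ univ

/-- `ρ(x)`, the distance of `x` to the boundary of `Ω`. -/
noncomputable def rho {n : ℕ} (Ω : Set (Rn n)) (x : Rn n) : ℝ :=
  Metric.infDist x (frontier Ω)

/-- John domain: a bounded domain `Ω` for which there are a distinguished point `x₀ ∈ Ω` and a
constant `C_J > 0` such that every `x ∈ Ω` is joined to `x₀` by a curve `γ : [0, l] → Ω`,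
parametrised by arclength (hence 1-Lipschitz), with `γ 0 = x`, `γ l = x₀`
and `ρ (γ t) ≥ C_J t`. -/
def IsJohnDomain {n : ℕ} (Ω : Set (Rn n)) : Prop :=
  IsProperDomain Ω ∧ Bornology.IsBounded Ω ∧
    ∃ x₀ ∈ Ω, ∃ CJ : ℝ, 0 < CJ ∧ ∀ x ∈ Ω, ∃ (l : ℝ) (γ : ℝ → Rn n),
      0 ≤ l ∧ HasUnitSpeedOn γ (Icc 0 l) ∧ MapsTo γ (Icc 0 l) Ω ∧ γ 0 = x ∧ γ l = x₀ ∧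
        ∀ t ∈ Icc 0 l, CJ * t ≤ rho Ω (γ t)

/-- The ball `B(z, C ρ(z))`. -/
noncomputable def rhoBall {n : ℕ} (Ω : Set (Rn n)) (C : ℝ) (z : Rn n) : Set (Rn n) :=
  Metric.ball z (C * rho Ω z)

/-- No point of `A \ B` lies in the same component of `Ω \ ∂B` as `x₀`. (Points of `∂B` lie in no
component of `Ω \ ∂B`; `connectedComponentIn F x₀` is empty when `x₀ ∉ F`.) -/
def SeparatesFrom {n : ℕ} (Ω B A : Set (Rn n)) (x₀ : Rn n) : Prop :=
  ∀ y ∈ A \ B, y ∉ connectedComponentIn (Ω \ frontier B) x₀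

/-- `γ` is a curve in `Ω` from `x` to `x₀` as in the separation property with constant `C`: for
each `t`, with `B = B(γ(t), C ρ(γ(t)))`, either `γ([0,t]) ⊆ B` or each point of `γ([0,t]) \ B`
is in a different component of `Ω \ ∂B` than `x₀`. -/
def IsSeparationCurve {n : ℕ} (Ω : Set (Rn n)) (C : ℝ) {x x₀ : Rn n} (γ : Path x x₀) : Prop :=
  (∀ t, γ t ∈ Ω) ∧
    ∀ t, γ '' Icc 0 t ⊆ rhoBall Ω C (γ t) ∨
      SeparatesFrom Ω (rhoBall Ω C (γ t)) (γ '' Icc 0 t) x₀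

/-- The separation property of `Ω` with distinguished point `x₀` and constant `C ≥ 1`. -/
def HasSeparationProperty {n : ℕ} (Ω : Set (Rn n)) (x₀ : Rn n) (C : ℝ) : Prop :=
  1 ≤ C ∧ ∀ x ∈ Ω, ∃ γ : Path x x₀, IsSeparationCurve Ω C γ

/-- `B` is a separating ball of the curve `γ`: for some `t` it is the ball `B(γ(t), C ρ(γ(t)))`,
and at this `t` the second alternative (and not the first) occurs. -/
def IsSeparatingBallOf {n : ℕ} (Ω : Set (Rn n)) (C : ℝ) {x x₀ : Rn n} (γ : Path x x₀)
    (B : Set (Rn n)) : Prop :=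
  ∃ t, B = rhoBall Ω C (γ t) ∧ ¬ γ '' Icc 0 t ⊆ B ∧ SeparatesFrom Ω B (γ '' Icc 0 t) x₀

/-- `B` is a separating ball of `Ω` (with distinguished point `x₀` and constant `C`): it is a
separating ball of some curve as in the separation property. -/
def IsSeparatingBall {n : ℕ} (Ω : Set (Rn n)) (x₀ : Rn n) (C : ℝ) (B : Set (Rn n)) : Prop :=
  ∃ x ∈ Ω, ∃ γ : Path x x₀, IsSeparationCurve Ω C γ ∧ IsSeparatingBallOf Ω C γ B

/-- The `B`-end `E_B`: the union of the components of `Ω \ B` that do not contain `x₀`. -/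
def ballEnd {n : ℕ} (Ω : Set (Rn n)) (x₀ : Rn n) (B : Set (Rn n)) : Set (Rn n) :=
  {y ∈ Ω \ B | x₀ ∉ connectedComponentIn (Ω \ B) y}

end SepJohn

namespace SepJohn

theorem sum_le_of_sum_pow_le {ρ : ℕ → ℝ} {n : ℕ} {K : ℝ} (hn : n ≠ 0) (hK : 1 ≤ K)
    (hρ : ∀ i, 0 ≤ ρ i) {m : ℕ}
    (h : ∀ k < m, ∑ i ∈ Finset.range (k + 1), ρ i ^ n ≤ K * ρ k ^ n) :
    ∀ k < m, ∑ i ∈ Finset.range (k + 1), ρ i ≤ n * K * K * ρ k := by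
  have hS : ∀ k, 0 ≤ ∑ i ∈ Finset.range (k + 1), ρ i ^ n := fun k =>
    Finset.sum_nonneg fun i _ => pow_nonneg (hρ i) n
  have hroot : ∀ k, ∃ s : ℝ, 0 ≤ s ∧ s ^ n = ∑ i ∈ Finset.range (k + 1), ρ i ^ n := fun k =>
    ⟨_, Real.rpow_nonneg (hS k) _, Real.rpow_inv_natCast_pow (hS k) hn⟩
  choose s hs0 hs using hroot
  have hn1 : (1 : ℝ) ≤ n := by exact_mod_cast Nat.one_le_iff_ne_zero.mpr hn
  have hnK : 1 ≤ n * K := one_le_mul_of_one_le_of_one_le hn1 hK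
  have key : ∀ k < m, ∑ i ∈ Finset.range (k + 1), ρ i ≤ n * K * s k := by
    intro k
    induction k with
    | zero =>
      intro _
      have h0 : ρ 0 = s 0 := by
        refine (pow_left_inj₀ (hρ 0) (hs0 0) hn).mp ?_
        rw [hs 0]; simp
      simp only [zero_add, Finset.sum_range_one, h0]
      nlinarith [hs0 0]
    | succ k ih =>
      intro hk
      have ih := ih (by omega)
      have hk' := h (k + 1) hk
      have hb : ρ (k + 1) ≤ s (k + 1) := by
        refine le_of_pow_le_pow_left₀ hn (hs0 _) ?_
        rw [hs, Finset.sum_range_succ]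
        linarith [hS k]
      have hstep : s k ≤ (1 - 1 / (n * K)) * s (k + 1) := by
        have hθ : 0 ≤ 1 - 1 / (n * K) := by
          rw [sub_nonneg, div_le_one (by linarith)]; exact hnK
        refine le_of_pow_le_pow_left₀ hn (mul_nonneg hθ (hs0 _)) ?_
        rw [mul_pow]
        have hber : 1 - 1 / K ≤ (1 - 1 / (n * K)) ^ n := by
          have := one_add_mul_le_pow (a := -(1 / (n * K))) (by linarith) n
          have e : 1 + (n : ℝ) * -(1 / (n * K)) = 1 - 1 / K := by
            have : (n : ℝ) ≠ 0 := by positivity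
            field_simp
            ring
          rw [e] at this
          simpa [sub_eq_add_neg] using this
        have hSk : s k ^ n ≤ (1 - 1 / K) * s (k + 1) ^ n := by
          rw [← hs (k + 1)] at hk'
          have e : s (k + 1) ^ n = s k ^ n + ρ (k + 1) ^ n := by
            rw [hs, hs, Finset.sum_range_succ]
          have : 1 / K * s (k + 1) ^ n ≤ ρ (k + 1) ^ n := by
            rw [one_div, inv_mul_le_iff₀ (by linarith)]
            exact hk'
          linarith
        exact hSk.trans (mul_le_mul_of_nonneg_right hber (pow_nonneg (hs0 _) n))
      rw [Finset.sum_range_succ]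
      have e : n * K * ((1 - 1 / (n * K)) * s (k + 1)) = n * K * s (k + 1) - s (k + 1) := by
        field_simp
      have := mul_le_mul_of_nonneg_left hstep (by linarith : 0 ≤ n * K)
      linarith
  intro k hk
  refine (key k hk).trans ?_
  rw [mul_assoc (n * K : ℝ)]
  refine mul_le_mul_of_nonneg_left ?_ (by linarith)
  refine le_of_pow_le_pow_left₀ hn (mul_nonneg (by linarith) (hρ k)) ?_
  rw [hs, mul_pow]
  exact (h k hk).trans (mul_le_mul_of_nonneg_right (le_self_pow₀ hK hn) (pow_nonneg (hρ k) n))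

section Rho

variable {n : ℕ} {Ω : Set (Rn n)}

theorem IsProperDomain.frontier_nonempty (hΩ : IsProperDomain Ω) : (frontier Ω).Nonempty :=
  nonempty_frontier_iff.mpr ⟨hΩ.2.1.nonempty, hΩ.2.2⟩

theorem IsProperDomain.rho_pos (hΩ : IsProperDomain Ω) {x : Rn n} (hx : x ∈ Ω) : 0 < rho Ω x := by
  refine (isClosed_frontier.notMem_iff_infDist_pos hΩ.frontier_nonempty).mp fun h => ?_
  rw [hΩ.1.frontier_eq] at h
  exact h.2 hx

theorem rho_nonneg (x : Rn n) : 0 ≤ rho Ω x := Metric.infDist_nonneg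

theorem rho_le_rho_add_dist (x y : Rn n) : rho Ω x ≤ rho Ω y + dist x y :=
  Metric.infDist_le_infDist_add_dist

theorem continuous_rho : Continuous (rho Ω) := Metric.continuous_infDist_pt _

theorem IsProperDomain.ball_rho_subset (hΩ : IsProperDomain Ω) {x : Rn n} (hx : x ∈ Ω) :
    Metric.ball x (rho Ω x) ⊆ Ω := by
  obtain ⟨y, hy, hxy⟩ := exists_mem_frontier_infDist_compl_eq_dist hx hΩ.2.2
  refine (Metric.ball_subset_ball ?_).trans Metric.ball_infDist_compl_subset
  rw [hxy]
  exact Metric.infDist_le_dist_of_mem hy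

end Rho

section BallEnd

variable {n : ℕ} {Ω B S : Set (Rn n)} {x₀ w : Rn n}

theorem subset_ballEnd_of_isPreconnected (hS : IsPreconnected S) (hSB : S ⊆ Ω \ B) (hwS : w ∈ S)
    (hw : w ∈ ballEnd Ω x₀ B) : S ⊆ ballEnd Ω x₀ B := by
  intro p hp
  refine ⟨hSB hp, fun h => hw.2 ?_⟩
  rwa [connectedComponentIn_eq (hS.subset_connectedComponentIn hwS hSB hp)]

/-- The trace of the exterior of a ball on a small ball about a boundary point lies in a connected
subset of the exterior. -/
theorem exists_isPreconnected_exterior {z p : Rn n} {R r : ℝ} (hR : 0 < R) (hp : dist p z = R)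
    (hrR : r ≤ R) :
    ∃ S, IsPreconnected S ∧ Metric.ball p r \ Metric.closedBall z R ⊆ S ∧
      S ⊆ Metric.ball p (2 * r) \ Metric.closedBall z R := by
  set e : Rn n := R⁻¹ • (p - z) with he
  have hpz : ‖p - z‖ = R := by rw [← dist_eq_norm, hp]
  have hpe : p - z = R • e := by rw [he, smul_inv_smul₀ hR.ne']
  have hen : ‖e‖ = 1 := by rw [he, norm_smul, hpz, norm_inv, Real.norm_of_nonneg hR.le, inv_mul_cancel₀ hR.ne']
  have hee : inner ℝ e e = 1 := by rw [real_inner_self_eq_norm_sq, hen, one_pow]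
  set H : Set (Rn n) := Metric.ball p (2 * r) ∩ {q | 0 < inner ℝ e (q - p)} with hH
  have hHconv : Convex ℝ H := by
    refine (convex_ball _ _).inter ?_
    intro a ha b hb s t hs ht hst
    simp only [mem_ofPred_eq] at *
    have : s • a + t • b - p = s • (a - p) + t • (b - p) := by
      have : p = (s + t) • p := by rw [hst, one_smul]
      conv_lhs => rw [this]
      module
    rw [this, inner_add_right, inner_smul_right, inner_smul_right]
    rcases hs.eq_or_lt with rfl | hs
    · have : t = 1 := by linarith
      subst this; simpa using hb
    · have := mul_pos hs ha
      have := mul_nonneg ht hb.le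
      linarith
  have hHext : ∀ q ∈ H, q ∉ Metric.closedBall z R := by
    intro q hq hqz
    rw [Metric.mem_closedBall, dist_eq_norm] at hqz
    have e1 : ‖q - z‖ ^ 2 = ‖q - p‖ ^ 2 + 2 * (R * inner ℝ e (q - p)) + R ^ 2 := by
      have : q - z = (q - p) + R • e := by rw [← hpe]; abel
      rw [this, norm_add_sq_real, inner_smul_right, real_inner_comm, norm_smul, hen,
        Real.norm_of_nonneg hR.le, mul_one]
    have : 0 < R * inner ℝ e (q - p) := mul_pos hR hq.2
    have : ‖q - z‖ ^ 2 ≤ R ^ 2 := by gcongr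
    nlinarith [sq_nonneg ‖q - p‖]
  have hin : ∀ v : Rn n, |inner ℝ e v| ≤ ‖v‖ := fun v => by
    have := abs_real_inner_le_norm e v
    rwa [hen, one_mul] at this
  have hseg : ∀ q ∈ Metric.ball p r \ Metric.closedBall z R, ∀ τ : ℝ, 0 ≤ τ → τ ≤ r →
      q + τ • e ∈ Metric.ball p (2 * r) \ Metric.closedBall z R := by
    rintro q ⟨hq, hqz⟩ τ h0 h1
    rw [Metric.mem_ball, dist_eq_norm] at hq
    rw [Metric.mem_closedBall, dist_eq_norm, not_le] at hqz
    constructor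
    · rw [Metric.mem_ball, dist_eq_norm, add_sub_right_comm]
      refine (norm_add_le _ _).trans_lt ?_
      rw [norm_smul, hen, Real.norm_of_nonneg h0]
      linarith
    · rw [Metric.mem_closedBall, dist_eq_norm, not_le, add_sub_right_comm]
      have e1 : ‖q - z + τ • e‖ ^ 2 = ‖q - z‖ ^ 2 + 2 * (τ * inner ℝ e (q - z)) + τ ^ 2 := by
        rw [norm_add_sq_real, inner_smul_right, real_inner_comm, norm_smul, hen,
          Real.norm_of_nonneg h0, mul_one]
      have e2 : inner ℝ e (q - z) = inner ℝ e (q - p) + R := by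
        have : q - z = (q - p) + R • e := by rw [← hpe]; abel
        rw [this, inner_add_right, inner_smul_right, hee, mul_one]
      have := (abs_le.mp (hin (q - p))).1
      have h3 : 0 ≤ τ * inner ℝ e (q - z) := mul_nonneg h0 (by rw [e2]; linarith)
      refine hqz.trans_le (le_of_pow_le_pow_left₀ two_ne_zero (norm_nonneg _) ?_)
      rw [e1]; nlinarith [sq_nonneg τ]
  refine ⟨H ∪ ⋃ q ∈ Metric.ball p r \ Metric.closedBall z R, segment ℝ q (q + r • e), ?_, ?_, ?_⟩
  · rcases (Metric.ball p r \ Metric.closedBall z R).eq_empty_or_nonempty with h0 | ⟨q₀, hq₀⟩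
    · simpa [h0] using hHconv.isPreconnected
    have hqH : ∀ q ∈ Metric.ball p r \ Metric.closedBall z R, q + r • e ∈ H := by
      intro q hq
      have hr : 0 < r := Metric.pos_of_mem_ball hq.1
      refine ⟨(hseg q hq r hr.le le_rfl).1, ?_⟩
      have h1 := hq.1
      rw [Metric.mem_ball, dist_eq_norm] at h1
      rw [mem_ofPred_eq, add_sub_right_comm, inner_add_right, inner_smul_right, hee]
      have := (abs_le.mp (hin (q - p))).1
      linarith
    refine isPreconnected_of_forall (q₀ + r • e) ?_
    rintro a (ha | ha)
    · exact ⟨H, subset_union_left, hqH q₀ hq₀, ha, hHconv.isPreconnected⟩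
    · obtain ⟨q, hq, ha⟩ := mem_iUnion₂.mp ha
      exact ⟨H ∪ segment ℝ q (q + r • e),
        union_subset_union_right _ (subset_biUnion_of_mem (u := fun q => segment ℝ q (q + r • e)) hq),
        .inl (hqH q₀ hq₀), .inr ha, hHconv.isPreconnected.union (q + r • e) (hqH q hq)
          (right_mem_segment _ _ _) (convex_segment _ _).isPreconnected⟩
  · intro q hq
    exact .inr (mem_biUnion hq (left_mem_segment _ _ _))
  · rintro a (ha | ha)
    · exact ⟨ha.1, hHext a ha⟩
    · simp only [mem_iUnion] at ha
      obtain ⟨q, hq, ha⟩ := ha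
      have hr : 0 < r := Metric.pos_of_mem_ball hq.1
      rw [segment_eq_image'] at ha
      obtain ⟨θ, hθ, rfl⟩ := ha
      simp only [add_sub_cancel_left, smul_smul]
      exact hseg q hq _ (mul_nonneg hθ.1 hr.le) (by nlinarith [hθ.2])

end BallEnd
section BallEnd

variable {n : ℕ} {Ω : Set (Rn n)} {x₀ y z : Rn n} {R : ℝ}

/-- A component of the complement of the sphere that lies outside the ball is no smaller, up to
points of the sphere, than the corresponding component of the complement of the open ball. -/
theorem connectedComponentIn_diff_ball_subset (hΩ : IsOpen Ω) (hR : 0 < R)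
    (hx₀ : R < dist x₀ z) :
    connectedComponentIn (Ω \ Metric.ball z R) x₀ ⊆
      closure (connectedComponentIn (Ω \ frontier (Metric.ball z R)) x₀) := by
  rw [frontier_ball _ hR.ne']
  by_cases hx₀Ω : x₀ ∈ Ω
  swap
  · rw [connectedComponentIn_eq_empty fun h => hx₀Ω h.1]; exact empty_subset _
  set V := Ω \ Metric.sphere z R with hV
  set U := connectedComponentIn V x₀ with hU
  have hVo : IsOpen V := hΩ.sdiff Metric.isClosed_sphere
  have hUo : IsOpen U := hVo.connectedComponentIn
  have hx₀V : x₀ ∈ V := ⟨hx₀Ω, fun h => hx₀.ne' h⟩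
  have hx₀U : x₀ ∈ U := mem_connectedComponentIn hx₀V
  have hcl : closure U ∩ V ⊆ U := by
    rintro q ⟨hq, hqV⟩
    obtain ⟨a, ha, haU⟩ := mem_closure_iff.mp hq _ hVo.connectedComponentIn
      (mem_connectedComponentIn hqV)
    have h1 := connectedComponentIn_eq ha
    have h2 := connectedComponentIn_eq haU
    rw [hU, h2, ← h1]
    exact mem_connectedComponentIn hqV
  have hUext : U ⊆ (Metric.closedBall z R)ᶜ := by
    have := (isPreconnected_connectedComponentIn (F := V) (x := x₀)).subset_left_of_subset_union
      (u := (Metric.closedBall z R)ᶜ) (v := Metric.ball z R)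
      Metric.isClosed_closedBall.isOpen_compl Metric.isOpen_ball
      (disjoint_compl_left.mono_right Metric.ball_subset_closedBall) (fun q hq => by
        have hq' := (connectedComponentIn_subset _ _ hq).2
        rcases lt_trichotomy (dist q z) R with h | h | h
        · exact .inr h
        · exact absurd h hq'
        · exact .inl (by simpa using h)) ⟨x₀, hx₀U, by simpa using hx₀⟩
    exact this
  set A := Ω \ Metric.ball z R
  have hopen : ∀ p ∈ closure U ∩ A, ∃ r > 0, Metric.ball p r ∩ A ⊆ closure U := by
    rintro p ⟨hpU, hpΩ, hpB⟩
    by_cases hps : p ∈ Metric.sphere z R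
    · obtain ⟨r₀, hr₀, hr₀Ω⟩ := Metric.isOpen_iff.mp hΩ p hpΩ
      set r := min (r₀ / 2) R
      have hr : 0 < r := lt_min (by positivity) hR
      obtain ⟨S, hS, hS1, hS2⟩ := exists_isPreconnected_exterior hR hps (min_le_right (r₀ / 2) R)
      have hSV : S ⊆ V := fun q hq => ⟨hr₀Ω (Metric.ball_subset_ball
        (by linarith [min_le_left (r₀ / 2) R]) (hS2 hq).1),
        fun h => (hS2 hq).2 (Metric.sphere_subset_closedBall h)⟩
      obtain ⟨a, hap, haU⟩ := mem_closure_iff.mp hpU _ Metric.isOpen_ball (Metric.mem_ball_self hr)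
      have hSU : S ⊆ U := by
        rw [hU, connectedComponentIn_eq haU]
        exact hS.subset_connectedComponentIn (hS1 ⟨hap, hUext haU⟩) hSV
      refine ⟨r, hr, ?_⟩
      rintro q ⟨hqp, hqΩ, hqB⟩
      refine mem_closure_iff.mpr fun W hW hqW => ?_
      have hq : q ∈ closure (Metric.closedBall z R)ᶜ := by
        rw [closure_compl, interior_closedBall _ hR.ne']
        exact hqB
      obtain ⟨b, hb, hbz⟩ := mem_closure_iff.mp hq _ (hW.inter Metric.isOpen_ball) ⟨hqW, hqp⟩
      exact ⟨b, hb.1, hSU (hS1 ⟨hb.2, hbz⟩)⟩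
    · obtain ⟨r, hr, hrU⟩ := Metric.isOpen_iff.mp hUo p (hcl ⟨hpU, hpΩ, hps⟩)
      exact ⟨r, hr, fun q hq => subset_closure (hrU hq.1)⟩
  choose! r hr hrU using hopen
  set W := ⋃ p ∈ closure U ∩ A, Metric.ball p (r p)
  have hW : IsOpen W := isOpen_biUnion fun _ _ => Metric.isOpen_ball
  have hWA : W ∩ A ⊆ closure U := by
    rintro q ⟨hqW, hqA⟩
    obtain ⟨p, hp, hq⟩ := mem_iUnion₂.mp hqW
    exact hrU p hp ⟨hq, hqA⟩
  have hx₀A : x₀ ∈ A := ⟨hx₀Ω, fun h => (lt_asymm hx₀ h).elim⟩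
  intro q hq
  by_contra hqU
  have hqA := connectedComponentIn_subset _ _ hq
  obtain ⟨a, haA, haW, haU⟩ := isPreconnected_connectedComponentIn (F := A) (x := x₀) W
    (closure U)ᶜ hW isClosed_closure.isOpen_compl (fun a ha => by
      by_cases haU : a ∈ closure U
      · have h := (⟨haU, connectedComponentIn_subset _ _ ha⟩ : a ∈ closure U ∩ A)
        exact .inl (mem_biUnion h (Metric.mem_ball_self (hr a h)))
      · exact .inr haU)
    ⟨x₀, mem_connectedComponentIn hx₀A, mem_biUnion (⟨subset_closure hx₀U, hx₀A⟩ :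
      x₀ ∈ closure U ∩ A) (Metric.mem_ball_self (hr _ ⟨subset_closure hx₀U, hx₀A⟩))⟩
    ⟨q, hq, hqU⟩
  exact haU (hWA ⟨haW, connectedComponentIn_subset _ _ haA⟩)

theorem mem_ballEnd_of_notMem_connectedComponentIn (hΩ : IsOpen Ω) (hR : 0 < R)
    (hx₀ : dist x₀ z ≠ R) (hy : y ∈ Ω) (hyB : R < dist y z)
    (h : y ∉ connectedComponentIn (Ω \ frontier (Metric.ball z R)) x₀) :
    y ∈ ballEnd Ω x₀ (Metric.ball z R) := by
  refine ⟨⟨hy, fun h => lt_asymm hyB h⟩, fun hc => h ?_⟩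
  have hx₀A := connectedComponentIn_subset _ _ hc
  have hlt : R < dist x₀ z := lt_of_le_of_ne (not_lt.mp hx₀A.2) hx₀.symm
  have hyc : y ∈ connectedComponentIn (Ω \ Metric.ball z R) x₀ := by
    rw [← connectedComponentIn_eq hc]
    exact mem_connectedComponentIn ⟨hy, fun h => lt_asymm hyB h⟩
  have hyV : y ∈ Ω \ frontier (Metric.ball z R) := by
    rw [frontier_ball _ hR.ne']
    exact ⟨hy, fun h => hyB.ne' h⟩
  have hVo : IsOpen (Ω \ frontier (Metric.ball z R)) := hΩ.sdiff isClosed_frontier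
  obtain ⟨a, ha, haU⟩ := mem_closure_iff.mp (connectedComponentIn_diff_ball_subset hΩ hR hlt hyc)
    _ hVo.connectedComponentIn (mem_connectedComponentIn hyV)
  rw [connectedComponentIn_eq haU, ← connectedComponentIn_eq ha]
  exact mem_connectedComponentIn hyV

end BallEnd

section Volume

variable {n : ℕ} {Ω : Set (Rn n)} {x₀ : Rn n} {C CE : ℝ}

theorem volume_ball_mono (a b : Rn n) {r s : ℝ} (h : r ≤ s) :
    volume (Metric.ball a r) ≤ volume (Metric.ball b s) := by
  rw [Measure.addHaar_ball_center volume a, Measure.addHaar_ball_center volume b]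
  exact measure_mono (Metric.ball_subset_ball h)

/-- The estimate for the ends of the separating balls of a separation curve. -/
def HasSmallEnds (Ω : Set (Rn n)) (C CE : ℝ) {x x₀ : Rn n} (γ : Path x x₀) : Prop :=
  ∀ B, IsSeparatingBallOf Ω C γ B → volume (ballEnd Ω x₀ B) ≤ ENNReal.ofReal CE * volume B

theorem volume_le_of_hasSmallEnds (hΩ : IsProperDomain Ω) (hx₀ : x₀ ∈ Ω) (hC : 1 ≤ C)
    (h : ∀ x ∈ Ω, ∃ γ : Path x x₀, IsSeparationCurve Ω C γ ∧ HasSmallEnds Ω C CE γ) :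
    volume Ω ≤ (1 + ENNReal.ofReal CE) * volume (rhoBall Ω C x₀) := by
  have hmem : x₀ ∈ rhoBall Ω C x₀ :=
    Metric.mem_ball_self (mul_pos (by linarith) (hΩ.rho_pos hx₀))
  by_cases hsub : Ω ⊆ rhoBall Ω C x₀
  · refine (measure_mono hsub).trans ?_
    rw [add_mul, one_mul]
    exact le_self_add
  · obtain ⟨x, hx, hxB⟩ := not_subset.mp hsub
    obtain ⟨γ, hγ, hend⟩ := h x hx
    have hnot : ¬ γ '' Icc 0 1 ⊆ rhoBall Ω C (γ 1) := fun hs => hxB (by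
      have := hs ⟨0, by simp, rfl⟩
      simpa using this)
    have hE := hend _ ⟨1, rfl, hnot, (hγ.2 1).resolve_left hnot⟩
    rw [γ.target] at hE
    have : Ω ⊆ rhoBall Ω C x₀ ∪ ballEnd Ω x₀ (rhoBall Ω C x₀) := fun y hy => by
      by_cases hyB : y ∈ rhoBall Ω C x₀
      · exact .inl hyB
      · exact .inr ⟨⟨hy, hyB⟩, fun hc => (connectedComponentIn_subset _ _ hc).2 hmem⟩
    refine (measure_mono this).trans ((measure_union_le _ _).trans ?_)
    rw [add_mul, one_mul]
    gcongr

theorem volume_biUnion_ball_le (hΩ : IsProperDomain Ω) (hC : 1 ≤ C)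
    (hvol : volume Ω ≤ (1 + ENNReal.ofReal CE) * volume (rhoBall Ω C x₀))
    {x : Rn n} {γ : Path x x₀} (hγ : IsSeparationCurve Ω C γ) (hend : HasSmallEnds Ω C CE γ)
    (s : unitInterval) :
    volume (⋃ r ∈ Icc 0 s, Metric.ball (γ r) (rho Ω (γ r) / 5)) ≤
      (1 + ENNReal.ofReal CE) * volume (Metric.ball (γ s) ((1 + C) ^ 2 * rho Ω (γ s))) := by
  set z := γ s with hz
  have hzΩ : z ∈ Ω := hγ.1 s
  have hρz : 0 < rho Ω z := hΩ.rho_pos hzΩ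
  have hR : 0 < C * rho Ω z := mul_pos (by linarith) hρz
  set N := ⋃ r ∈ Icc 0 s, Metric.ball (γ r) (rho Ω (γ r) / 5)
  have hsmall : ∀ r, Metric.ball (γ r) (rho Ω (γ r) / 5) ⊆ Ω := fun r =>
    (Metric.ball_subset_ball (by linarith [rho_nonneg (Ω := Ω) (γ r)])).trans
      (hΩ.ball_rho_subset (hγ.1 r))
  have hnear : ∀ r, (∃ p ∈ Metric.ball (γ r) (rho Ω (γ r) / 5), dist p z ≤ C * rho Ω z) →
      Metric.ball (γ r) (rho Ω (γ r) / 5) ⊆ Metric.ball z ((1 + C) ^ 2 * rho Ω z) := by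
    rintro r ⟨p, hp, hpz⟩ q hq
    rw [Metric.mem_ball] at hp hq ⊢
    have h1 := dist_triangle (γ r) p z
    rw [dist_comm (γ r) p] at h1
    have h2 := rho_le_rho_add_dist (Ω := Ω) (γ r) z
    have h3 := dist_triangle q (γ r) z
    nlinarith [sq_nonneg C]
  by_cases hx₀z : dist x₀ z = C * rho Ω z
  · have hN : N ⊆ Ω := iUnion₂_subset fun r _ => hsmall r
    refine (measure_mono hN).trans (hvol.trans ?_)
    refine mul_le_mul' le_rfl (volume_ball_mono _ _ ?_)
    have := rho_le_rho_add_dist (Ω := Ω) x₀ z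
    nlinarith
  rcases em (γ '' Icc 0 s ⊆ rhoBall Ω C z) with ha | ha
  · have hN : N ⊆ Metric.ball z ((1 + C) ^ 2 * rho Ω z) := iUnion₂_subset fun r hr =>
      hnear r ⟨γ r, Metric.mem_ball_self (by linarith [hΩ.rho_pos (hγ.1 r)]),
        (ha ⟨r, hr, rfl⟩ : γ r ∈ Metric.ball _ _).le⟩
    refine (measure_mono hN).trans ?_
    rw [add_mul, one_mul]
    exact le_self_add
  · have hb := (hγ.2 s).resolve_left ha
    have hE := hend _ ⟨s, rfl, ha, hb⟩
    have hN : N ⊆ Metric.ball z ((1 + C) ^ 2 * rho Ω z) ∪ ballEnd Ω x₀ (rhoBall Ω C z) := by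
      refine iUnion₂_subset fun r hr => ?_
      by_cases hn : ∃ p ∈ Metric.ball (γ r) (rho Ω (γ r) / 5), dist p z ≤ C * rho Ω z
      · exact (hnear r hn).trans subset_union_left
      · push Not at hn
        have hmem : γ r ∈ Metric.ball (γ r) (rho Ω (γ r) / 5) :=
          Metric.mem_ball_self (by linarith [hΩ.rho_pos (hγ.1 r)])
        have hfar := hn _ hmem
        refine (subset_ballEnd_of_isPreconnected (convex_ball _ _).isPreconnected
          (fun p hp => ⟨hsmall r hp, fun h => lt_asymm (hn p hp) h⟩) hmem ?_).trans
            subset_union_right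
        exact mem_ballEnd_of_notMem_connectedComponentIn hΩ.1 hR hx₀z (hγ.1 r) hfar
          (hb _ ⟨⟨r, hr, rfl⟩, fun h => lt_asymm hfar h⟩)
    refine (measure_mono hN).trans ((measure_union_le _ _).trans ?_)
    rw [add_mul, one_mul]
    gcongr
    refine hE.trans ?_
    refine mul_le_mul' le_rfl (volume_ball_mono _ _ ?_)
    nlinarith [sq_nonneg C]

end Volume
section Chain

variable {n : ℕ} {Ω : Set (Rn n)} {x₀ : Rn n} {C CE : ℝ}

theorem hasUnitSpeedOn_of_edist_eq {E : Type*} [PseudoEMetricSpace E] {f : ℝ → E} {s : Set ℝ}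
    (h : ∀ a ∈ s, ∀ b ∈ s, edist (f a) (f b) = edist a b) : HasUnitSpeedOn f s := by
  rw [HasUnitSpeedOn, hasConstantSpeedOnWith_iff_ordered]
  intro a ha b hb hab
  rw [NNReal.coe_one, one_mul]
  have hab' : edist a b = ENNReal.ofReal (b - a) := by
    rw [edist_comm, edist_dist, Real.dist_eq, abs_of_nonneg (by linarith)]
  have ha' : a ∈ s ∩ Icc a b := ⟨ha, le_rfl, hab⟩
  have hb' : b ∈ s ∩ Icc a b := ⟨hb, hab, le_rfl⟩
  refine le_antisymm ?_ ?_
  · have hL : LipschitzOnWith 1 f s := fun p hp q hq => by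
      rw [h p hp q hq, ENNReal.coe_one, one_mul]
    have h1 := hL.comp_eVariationOn_le (g := id) (s := s ∩ Icc a b) (fun p hp => hp.1)
    rw [ENNReal.coe_one, one_mul] at h1
    exact h1.trans ((monotoneOn_id (s := s)).eVariationOn_eq ha hb).le
  · rw [← hab', ← h a ha b hb]
    exact eVariationOn.edist_le f ha' hb'

theorem dist_le_of_hasUnitSpeedOn {E : Type*} [PseudoMetricSpace E] {f : ℝ → E} {s : Set ℝ}
    (hf : HasUnitSpeedOn f s) {a b : ℝ} (ha : a ∈ s) (hb : b ∈ s) (hab : a ≤ b) :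
    dist (f a) (f b) ≤ b - a := by
  have h := eVariationOn.edist_le f (s := s ∩ Icc a b) ⟨ha, le_rfl, hab⟩ ⟨hb, hab, le_rfl⟩
  rw [hf ha hb, NNReal.coe_one, one_mul, edist_dist,
    ENNReal.ofReal_le_ofReal_iff (by linarith)] at h
  exact h

theorem continuousOn_of_hasUnitSpeedOn {E : Type*} [PseudoMetricSpace E] {f : ℝ → E} {s : Set ℝ}
    (hf : HasUnitSpeedOn f s) : ContinuousOn f s := by
  refine (LipschitzOnWith.of_dist_le_mul (K := 1) fun a ha b hb => ?_).continuousOn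
  rw [NNReal.coe_one, one_mul, Real.dist_eq]
  rcases le_total a b with h | h
  · rw [abs_sub_comm, abs_of_nonneg (by linarith)]
    exact dist_le_of_hasUnitSpeedOn hf ha hb h
  · rw [dist_comm, abs_of_nonneg (by linarith)]
    exact dist_le_of_hasUnitSpeedOn hf hb ha h

theorem exists_unitSpeed_snoc {f : ℝ → Rn n} {l : ℝ}
    (hf : HasUnitSpeedOn f (Icc 0 l)) (q : Rn n) :
    ∃ g : ℝ → Rn n, HasUnitSpeedOn g (Icc 0 (l + dist (f l) q)) ∧ EqOn g f (Icc 0 l) ∧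
      g (l + dist (f l) q) = q ∧
      ∀ t ∈ Icc l (l + dist (f l) q), dist (g t) (f l) ≤ dist (f l) q := by
  set d := dist (f l) q with hd
  rcases eq_or_ne (f l) q with hq | hq
  · have hd0 : d = 0 := by rw [hd, hq, dist_self]
    rw [hd0, add_zero]
    refine ⟨f, hf, fun _ _ => rfl, hq, fun t ht => ?_⟩
    rw [le_antisymm ht.2 ht.1, dist_self]
  have hdpos : 0 < d := dist_pos.mpr hq
  set e : Rn n := d⁻¹ • (q - f l) with he
  have hen : ‖e‖ = 1 := by
    rw [he, norm_smul, ← dist_eq_norm, dist_comm, ← hd, norm_inv, Real.norm_of_nonneg hdpos.le,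
      inv_mul_cancel₀ hdpos.ne']
  set g : ℝ → Rn n := fun t => if t ≤ l then f t else f l + (t - l) • e with hg
  have hgl : EqOn g f (Icc 0 l) := fun t ht => if_pos ht.2
  have hgr : ∀ t, l ≤ t → g t = f l + (t - l) • e := fun t ht => by
    rcases ht.eq_or_lt with rfl | ht
    · simp [hg]
    · exact if_neg ht.not_ge
  refine ⟨g, ?_, hgl, ?_, ?_⟩
  · refine HasUnitSpeedOn.Icc_Icc (y := l) ?_ ?_
    · intro a ha b hb
      rw [← hf ha hb]
      exact eVariationOn.congr (hgl.mono inter_subset_left)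
    · refine hasUnitSpeedOn_of_edist_eq fun a ha b hb => ?_
      rw [hgr a ha.1, hgr b hb.1, edist_dist, edist_dist, dist_add_left, dist_eq_norm, ← sub_smul,
        norm_smul, hen, mul_one, Real.dist_eq, Real.norm_eq_abs]
      congr 2
      ring
  · rw [hgr _ (by linarith), add_sub_cancel_left, he, smul_inv_smul₀ hdpos.ne', add_sub_cancel]
  · intro t ht
    rw [hgr t ht.1, dist_eq_norm, add_sub_cancel_left, norm_smul, hen, mul_one,
      Real.norm_of_nonneg (by linarith [ht.1])]
    linarith [ht.2]

/-- The polygonal line through a chain of points is a John curve if the distances to the boundary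
along the chain have geometric growth. -/
theorem exists_johnCurve_of_chain (hΩ : IsProperDomain Ω) {p : ℕ → Rn n} {L : ℝ} (hL : 0 < L)
    (hp : ∀ i, p i ∈ Ω) :
    ∀ m : ℕ, (∀ i < m, dist (p i) (p (i + 1)) ≤ rho Ω (p i) / 2) →
      (∀ k < m, ∑ i ∈ Finset.range (k + 1), rho Ω (p i) ≤ L * rho Ω (p k)) →
      ∃ (l : ℝ) (g : ℝ → Rn n), 0 ≤ l ∧ HasUnitSpeedOn g (Icc 0 l) ∧ MapsTo g (Icc 0 l) Ω ∧
        g 0 = p 0 ∧ g l = p m ∧ l ≤ (∑ i ∈ Finset.range m, rho Ω (p i)) / 2 ∧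
        ∀ t ∈ Icc 0 l, 1 / L * t ≤ rho Ω (g t) := by
  intro m
  induction m with
  | zero =>
    intro _ _
    refine ⟨0, fun _ => p 0, le_rfl, ?_, fun _ _ => hp 0, rfl, rfl, by simp, ?_⟩
    · exact hasConstantSpeedOnWith_of_subsingleton _ (by simp) 1
    · intro t ht
      rw [le_antisymm ht.2 ht.1, mul_zero]
      exact rho_nonneg _
  | succ m ih =>
    intro hstep hsum
    obtain ⟨l, f, hl, hf, hfΩ, hf0, hfl, hlen, hJ⟩ :=
      ih (fun i hi => hstep i (by omega)) (fun k hk => hsum k (by omega))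
    obtain ⟨g, hg, hgf, hgq, hgd⟩ := exists_unitSpeed_snoc hf (p (m + 1))
    rw [hfl] at hg hgq hgd
    set d := dist (p m) (p (m + 1))
    have hdm : d ≤ rho Ω (p m) / 2 := hstep m (by omega)
    have hd0 : 0 ≤ d := dist_nonneg
    have hlen' : l + d ≤ (∑ i ∈ Finset.range (m + 1), rho Ω (p i)) / 2 := by
      rw [Finset.sum_range_succ]; linarith
    have hρ : 0 < rho Ω (p m) := hΩ.rho_pos (hp m)
    refine ⟨l + d, g, by linarith, hg, ?_, ?_, hgq, hlen', ?_⟩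
    · intro t ht
      rcases le_total t l with h | h
      · rw [hgf ⟨ht.1, h⟩]; exact hfΩ ⟨ht.1, h⟩
      · refine hΩ.ball_rho_subset (hp m) ?_
        have := hgd t ⟨h, ht.2⟩
        rw [Metric.mem_ball]; linarith
    · rw [hgf ⟨le_rfl, hl⟩, hf0]
    · intro t ht
      rcases le_total t l with h | h
      · rw [hgf ⟨ht.1, h⟩]; exact hJ t ⟨ht.1, h⟩
      · have h1 := hgd t ⟨h, ht.2⟩
        have h2 := rho_le_rho_add_dist (Ω := Ω) (p m) (g t)
        rw [dist_comm] at h2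
        have h3 := hsum m (by omega)
        rw [one_div, inv_mul_le_iff₀ hL]
        have h4 : L * (rho Ω (p m) / 2) ≤ L * rho Ω (g t) :=
          mul_le_mul_of_nonneg_left (by linarith) hL.le
        have := ht.2
        linarith

theorem exists_lastExit {x y : Rn n} (γ : Path x y) (t : unitInterval) :
    ∃ u, t ≤ u ∧ dist (γ u) (γ t) ≤ rho Ω (γ t) / 2 ∧
      (u ≠ 1 → ∀ v, u ≤ v → rho Ω (γ t) / 2 ≤ dist (γ v) (γ t)) := by
  set S := Ici t ∩ {u | dist (γ u) (γ t) ≤ rho Ω (γ t) / 2}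
  have hcont : Continuous fun u => dist (γ u) (γ t) := γ.continuous.dist continuous_const
  have hSc : IsClosed S := isClosed_Ici.inter (isClosed_le hcont continuous_const)
  obtain ⟨u, huS, hu⟩ := hSc.isCompact.exists_isGreatest
    ⟨t, ⟨le_refl t, by simp only [mem_ofPred_eq, dist_self]; linarith [rho_nonneg (Ω := Ω) (γ t)]⟩⟩
  refine ⟨u, huS.1, huS.2, fun hu1 v huv => ?_⟩
  have hlt : u < 1 := lt_of_le_of_ne unitInterval.le_one' hu1
  have hsub : Ici u ⊆ {v | rho Ω (γ t) / 2 ≤ dist (γ v) (γ t)} := by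
    rw [← closure_Ioi' (a := u) ⟨1, hlt⟩]
    refine closure_minimal (fun w hw => ?_) (isClosed_le continuous_const hcont)
    by_contra hlt'
    have hwS : dist (γ w) (γ t) ≤ rho Ω (γ t) / 2 := (not_le.mp hlt').le
    have htw : t ≤ w := le_trans huS.1 (le_of_lt hw)
    exact lt_irrefl _ (lt_of_lt_of_le hw (hu ⟨htw, hwS⟩))
  exact hsub huv

theorem exists_chain (hΩ : IsProperDomain Ω) {x y : Rn n} (γ : Path x y) (hγ : ∀ t, γ t ∈ Ω) :
    ∃ (m : ℕ) (t : ℕ → unitInterval), t 0 = 0 ∧ t m = 1 ∧ Monotone t ∧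
      (∀ i, dist (γ (t i)) (γ (t (i + 1))) ≤ rho Ω (γ (t i)) / 2) ∧
      ∀ i j, i < j → j < m → rho Ω (γ (t i)) / 2 ≤ dist (γ (t j)) (γ (t i)) := by
  choose f hf1 hf2 hf3 using exists_lastExit (Ω := Ω) γ
  set t : ℕ → unitInterval := fun k => f^[k] 0 with ht
  have hsucc : ∀ k, t (k + 1) = f (t k) := fun k => Function.iterate_succ_apply' f k 0
  have hmono : Monotone t := monotone_nat_of_le_succ fun k => by rw [hsucc]; exact hf1 _
  have hend : ∃ m, t m = 1 := by
    by_contra! hne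
    obtain ⟨u₀, -, hu₀⟩ := isCompact_univ.exists_isMinOn univ_nonempty
      (continuous_rho (Ω := Ω).comp γ.continuous).continuousOn
    have hδ : 0 < rho Ω (γ u₀) := hΩ.rho_pos (hγ u₀)
    obtain ⟨ε, hε, hunif⟩ := Metric.uniformContinuous_iff.mp
      (CompactSpace.uniformContinuous_of_continuous γ.continuous) (rho Ω (γ u₀) / 2) (by linarith)
    have hgap : ∀ k, ε ≤ (t (k + 1) : ℝ) - t k := by
      intro k
      by_contra! hlt
      have h0 : (t k : ℝ) ≤ t (k + 1) := hmono (Nat.le_succ k)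
      have h1 := hunif (a := t (k + 1)) (b := t k) (by
        rw [Subtype.dist_eq, Real.dist_eq, abs_of_nonneg (by linarith)]; exact hlt)
      have h2 := hf3 (t k) (by rw [← hsucc]; exact hne _) (t (k + 1)) (hsucc k).ge
      have h3 : rho Ω (γ u₀) ≤ rho Ω (γ (t k)) := hu₀ (mem_univ (t k))
      linarith
    have hbig : ∀ k : ℕ, k * ε ≤ (t k : ℝ) := by
      intro k
      induction k with
      | zero => simpa using (t 0).2.1
      | succ k ih => push_cast; linarith [hgap k]
    obtain ⟨k, hk⟩ := exists_nat_gt (1 / ε)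
    rw [div_lt_iff₀ hε] at hk
    linarith [hbig k, (t k).2.2]
  classical
  refine ⟨Nat.find hend, t, rfl, Nat.find_spec hend, hmono, fun i => ?_, fun i j hij hj => ?_⟩
  · rw [dist_comm, hsucc]; exact hf2 _
  · refine hf3 (t i) ?_ (t j) ?_
    · rw [← hsucc]; exact Nat.find_min hend (by omega)
    · rw [← hsucc]; exact hmono hij

theorem sum_rho_pow_le (hΩ : IsProperDomain Ω) (hC : 1 ≤ C) (hCE : 0 < CE)
    (hvol : volume Ω ≤ (1 + ENNReal.ofReal CE) * volume (rhoBall Ω C x₀))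
    {x : Rn n} {γ : Path x x₀} (hγ : IsSeparationCurve Ω C γ) (hend : HasSmallEnds Ω C CE γ)
    {m : ℕ} {t : ℕ → unitInterval} (ht : Monotone t)
    (hsep : ∀ i j, i < j → j < m → rho Ω (γ (t i)) / 2 ≤ dist (γ (t j)) (γ (t i)))
    {k : ℕ} (hk : k < m) :
    ∑ i ∈ Finset.range (k + 1), rho Ω (γ (t i)) ^ n ≤
      (1 + CE) * (5 * (1 + C) ^ 2) ^ n * rho Ω (γ (t k)) ^ n := by
  have hpos : ∀ i, 0 < rho Ω (γ (t i)) := fun i => hΩ.rho_pos (hγ.1 _)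
  have hdisj : ∀ i j, i < j → j < m → Disjoint (Metric.ball (γ (t i)) (rho Ω (γ (t i)) / 5))
      (Metric.ball (γ (t j)) (rho Ω (γ (t j)) / 5)) := by
    intro i j hij hj
    refine Metric.ball_disjoint_ball ?_
    have h1 := hsep i j hij hj
    have h2 := rho_le_rho_add_dist (Ω := Ω) (γ (t j)) (γ (t i))
    rw [dist_comm (γ (t i))]
    linarith
  have hpd : (↑(Finset.range (k + 1)) : Set ℕ).PairwiseDisjoint
      fun i => Metric.ball (γ (t i)) (rho Ω (γ (t i)) / 5) := by
    intro i hi j hj hij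
    simp only [Finset.coe_range, mem_Iio] at hi hj
    rcases lt_or_gt_of_ne hij with h | h
    · exact hdisj i j h (by omega)
    · exact (hdisj j i h (by omega)).symm
  have hN := volume_biUnion_ball_le hΩ hC hvol hγ hend (t k)
  have hsub : (⋃ i ∈ Finset.range (k + 1), Metric.ball (γ (t i)) (rho Ω (γ (t i)) / 5)) ⊆
      ⋃ r ∈ Icc 0 (t k), Metric.ball (γ r) (rho Ω (γ r) / 5) := by
    refine iUnion₂_subset fun i hi => ?_
    exact subset_biUnion_of_mem (u := fun r => Metric.ball (γ r) (rho Ω (γ r) / 5))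
      (⟨unitInterval.nonneg', ht (by simpa [Nat.lt_succ_iff] using hi)⟩ : t i ∈ Icc 0 (t k))
  have h := (measure_mono (μ := volume) hsub).trans hN
  rw [measure_biUnion_finset hpd fun _ _ => Metric.isOpen_ball.measurableSet] at h
  have hV0 : volume (Metric.ball (0 : Rn n) 1) ≠ 0 := (Metric.measure_ball_pos _ _ one_pos).ne'
  have hVt : volume (Metric.ball (0 : Rn n) 1) ≠ ⊤ := measure_ball_lt_top.ne
  have hball : ∀ (a : Rn n) {r : ℝ}, 0 < r → volume (Metric.ball a r) =
      ENNReal.ofReal (r ^ n) * volume (Metric.ball (0 : Rn n) 1) := fun a r hr => by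
    rw [Measure.addHaar_ball_of_pos volume a hr, finrank_euclideanSpace_fin]
  rw [Finset.sum_congr rfl fun i _ => hball (γ (t i)) (div_pos (hpos i) (by norm_num : (0 : ℝ) < 5)),
    hball _ (mul_pos (by positivity) (hpos k)), ← Finset.sum_mul, ← mul_assoc,
    ENNReal.mul_le_mul_iff_left hV0 hVt,
    ← ENNReal.ofReal_sum_of_nonneg fun i _ => pow_nonneg (by linarith [hpos i]) n,
    ← ENNReal.ofReal_one, ← ENNReal.ofReal_add zero_le_one hCE.le,
    ← ENNReal.ofReal_mul (by linarith), ENNReal.ofReal_le_ofReal_iff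
      (mul_nonneg (by linarith) (pow_nonneg (mul_nonneg (by positivity) (hpos k).le) n))] at h
  simp only [div_pow] at h
  rw [← Finset.sum_div, div_le_iff₀ (by positivity)] at h
  refine h.trans (le_of_eq ?_)
  rw [mul_pow, mul_pow]
  ring

end Chain

section Main

variable {n : ℕ} {Ω : Set (Rn n)} {x₀ : Rn n} {C CE : ℝ}

theorem isJohnDomain_of_hasSmallEnds (hn : n ≠ 0) (hΩ : IsProperDomain Ω) (hC : 1 ≤ C)
    (hCE : 0 < CE)
    (h : ∀ x ∈ Ω, ∃ γ : Path x x₀, IsSeparationCurve Ω C γ ∧ HasSmallEnds Ω C CE γ) :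
    IsJohnDomain Ω := by
  have hx₀ : x₀ ∈ Ω := by
    obtain ⟨x, hx⟩ := hΩ.2.1.nonempty
    obtain ⟨γ, hγ, -⟩ := h x hx
    simpa using hγ.1 1
  have hvol := volume_le_of_hasSmallEnds hΩ hx₀ hC h
  set K := (1 + CE) * (5 * (1 + C) ^ 2) ^ n
  have hK : 1 ≤ K := one_le_mul_of_one_le_of_one_le (by linarith)
    (one_le_pow₀ (by nlinarith))
  set L := n * K * K
  have hL : 0 < L := by
    have : (0 : ℝ) < n := by exact_mod_cast Nat.pos_of_ne_zero hn
    positivity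
  have hcurve : ∀ x ∈ Ω, ∃ (l : ℝ) (g : ℝ → Rn n),
      0 ≤ l ∧ HasUnitSpeedOn g (Icc 0 l) ∧ MapsTo g (Icc 0 l) Ω ∧ g 0 = x ∧ g l = x₀ ∧
        ∀ t ∈ Icc 0 l, 1 / L * t ≤ rho Ω (g t) := by
    intro x hx
    obtain ⟨γ, hγ, hend⟩ := h x hx
    obtain ⟨m, t, ht0, htm, hmono, hstep, hsep⟩ := exists_chain hΩ γ hγ.1
    have hsum := sum_le_of_sum_pow_le (ρ := fun i => rho Ω (γ (t i))) hn hK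
      (fun i => rho_nonneg _) (m := m)
      (fun k hk => sum_rho_pow_le hΩ hC hCE hvol hγ hend hmono hsep hk)
    obtain ⟨l, g, h1, h2, h3, h4, h5, -, h6⟩ := exists_johnCurve_of_chain hΩ hL
      (p := fun i => γ (t i)) (fun i => hγ.1 _) m (fun i _ => hstep i) hsum
    refine ⟨l, g, h1, h2, h3, ?_, ?_, h6⟩
    · rw [h4, ht0, γ.source]
    · rw [h5, htm, γ.target]
  refine ⟨hΩ, ?_, x₀, hx₀, 1 / L, by positivity, hcurve⟩
  refine (Metric.isBounded_closedBall (x := x₀) (r := L * rho Ω x₀)).subset ?_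
  intro x hx
  obtain ⟨l, g, hl, hg, -, hg0, hgl, hJ⟩ := hcurve x hx
  have h1 := hJ l ⟨hl, le_rfl⟩
  rw [hgl, one_div, inv_mul_le_iff₀ hL] at h1
  have h2 := dist_le_of_hasUnitSpeedOn hg ⟨le_rfl, hl⟩ ⟨hl, le_rfl⟩ hl
  rw [hg0, hgl] at h2
  rw [Metric.mem_closedBall]
  linarith

theorem exists_ballEnd_bound (hΩ : IsProperDomain Ω) (hJ : IsJohnDomain Ω) (hx₀ : x₀ ∈ Ω)
    (hC : 1 ≤ C) :
    ∃ K : ℝ, 0 < K ∧ ∀ z ∈ Ω, ballEnd Ω x₀ (rhoBall Ω C z) ⊆ Metric.ball z (K * rho Ω z) := by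
  obtain ⟨-, hbdd, xJ, hxJ, CJ, hCJ, hcurve⟩ := hJ
  obtain ⟨σ, hσ⟩ := (hΩ.1.isConnected_iff_isPathConnected.mp hΩ.2.1).joinedIn xJ hxJ x₀ hx₀
  obtain ⟨u₀, -, hu₀⟩ := isCompact_univ.exists_isMinOn univ_nonempty
    (continuous_rho (Ω := Ω).comp σ.continuous).continuousOn
  set δ := rho Ω (σ u₀)
  have hδ : 0 < δ := hΩ.rho_pos (hσ u₀)
  obtain ⟨D, hD⟩ := Metric.isBounded_iff.mp hbdd
  have hD0 : 0 ≤ D := dist_nonneg.trans (hD hx₀ hx₀)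
  refine ⟨(1 + C) / CJ + C + 1 + D * (1 + C) / δ, by positivity, fun z hz y hy => ?_⟩
  have hρz : 0 < rho Ω z := hΩ.rho_pos hz
  have hinB : ∀ w ∈ rhoBall Ω C z, rho Ω w ≤ (1 + C) * rho Ω z := fun w hw => by
    have h1 := rho_le_rho_add_dist (Ω := Ω) w z
    have h2 : dist w z < C * rho Ω z := hw
    linarith
  have hD' : 0 ≤ D * (1 + C) / δ * rho Ω z := by positivity
  obtain ⟨l, g, hl, hg, hgΩ, hg0, hgl, hJ⟩ := hcurve y hy.1.1
  rw [Metric.mem_ball]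
  by_cases hhit : ∃ t ∈ Icc 0 l, g t ∈ rhoBall Ω C z
  · obtain ⟨t, ht, htB⟩ := hhit
    have h1 := dist_le_of_hasUnitSpeedOn hg ⟨le_rfl, hl⟩ ht ht.1
    rw [hg0] at h1
    have h2 : dist (g t) z < C * rho Ω z := htB
    have h3 : t ≤ (1 + C) / CJ * rho Ω z := by
      rw [div_mul_eq_mul_div, le_div_iff₀ hCJ, mul_comm]
      exact (hJ t ht).trans (hinB _ htB)
    have := dist_triangle y (g t) z
    linarith
  · push Not at hhit
    have hgc : IsPreconnected (g '' Icc 0 l) :=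
      isPreconnected_Icc.image _ (continuousOn_of_hasUnitSpeedOn hg)
    have hJE : xJ ∈ ballEnd Ω x₀ (rhoBall Ω C z) := by
      refine subset_ballEnd_of_isPreconnected hgc ?_ ⟨0, ⟨le_rfl, hl⟩, hg0⟩ hy
        ⟨l, ⟨hl, le_rfl⟩, hgl⟩
      rintro _ ⟨t, ht, rfl⟩
      exact ⟨hgΩ ht, hhit t ht⟩
    have hσhit : ∃ u, σ u ∈ rhoBall Ω C z := by
      by_contra! hno
      have := subset_ballEnd_of_isPreconnected (isPreconnected_range σ.continuous)
        (by rintro _ ⟨u, rfl⟩; exact ⟨hσ u, hno u⟩) ⟨0, σ.source⟩ hJE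
        (⟨1, σ.target⟩ : x₀ ∈ range σ)
      exact this.2 (mem_connectedComponentIn this.1)
    obtain ⟨u, hu⟩ := hσhit
    have h1 : δ ≤ (1 + C) * rho Ω z := (hu₀ (mem_univ u)).trans (hinB _ hu)
    have h2 : D ≤ D * (1 + C) / δ * rho Ω z := by
      rw [div_mul_eq_mul_div, le_div_iff₀ hδ, mul_assoc]
      exact mul_le_mul_of_nonneg_left h1 hD0
    have h3 := hD hy.1.1 hz
    have h4 : 0 < (1 + C) / CJ * rho Ω z := by positivity
    nlinarith

theorem exists_volume_ballEnd_le (hΩ : IsProperDomain Ω) (hJ : IsJohnDomain Ω) (hC : 1 ≤ C) :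
    ∃ CE : ℝ, 0 < CE ∧ ∀ B, IsSeparatingBall Ω x₀ C B →
      volume (ballEnd Ω x₀ B) ≤ ENNReal.ofReal CE * volume B := by
  by_cases hx₀ : x₀ ∈ Ω
  swap
  · refine ⟨1, one_pos, ?_⟩
    rintro B ⟨x, -, γ, hγ, -⟩
    exact absurd (by simpa using hγ.1 1) hx₀
  obtain ⟨K, hK, hsub⟩ := exists_ballEnd_bound hΩ hJ hx₀ hC
  have hC0 : 0 < C := by linarith
  refine ⟨(K / C) ^ n, by positivity, ?_⟩
  rintro B ⟨x, -, γ, hγ, t, rfl, -, -⟩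
  refine (measure_mono (hsub _ (hγ.1 t))).trans ?_
  have : K * rho Ω (γ t) = K / C * (C * rho Ω (γ t)) := by field_simp
  rw [this, Measure.addHaar_ball_mul_of_pos volume _ (by positivity), finrank_euclideanSpace_fin,
    rhoBall, Measure.addHaar_ball_center volume (γ t)]

end Main
end SepJohn

theorem theorem3p1 {n : ℕ} (hn : 2 ≤ n) (Ω : Set (SepJohn.Rn n)) (hΩ : SepJohn.IsProperDomain Ω)
    (x₀ : SepJohn.Rn n) (Cs : ℝ) (hsep : SepJohn.HasSeparationProperty Ω x₀ Cs) :
    (SepJohn.IsJohnDomain Ω ↔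
      ∃ CE : ℝ, 0 < CE ∧ ∀ B, SepJohn.IsSeparatingBall Ω x₀ Cs B →
        volume (SepJohn.ballEnd Ω x₀ B) ≤ ENNReal.ofReal CE * volume B) ∧
    (SepJohn.IsJohnDomain Ω ↔
      ∃ CE : ℝ, 0 < CE ∧ ∀ x ∈ Ω, ∃ γ : Path x x₀, SepJohn.IsSeparationCurve Ω Cs γ ∧
        ∀ B, SepJohn.IsSeparatingBallOf Ω Cs γ B →
          volume (SepJohn.ballEnd Ω x₀ B) ≤ ENNReal.ofReal CE * volume B) := by
  have all_of_john := fun hJ : SepJohn.IsJohnDomain Ω =>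
    SepJohn.exists_volume_ballEnd_le (x₀ := x₀) hΩ hJ hsep.1
  have one_of_all : ∀ CE : ℝ, (∀ B, SepJohn.IsSeparatingBall Ω x₀ Cs B →
      volume (SepJohn.ballEnd Ω x₀ B) ≤ ENNReal.ofReal CE * volume B) →
      ∀ x ∈ Ω, ∃ γ : Path x x₀, SepJohn.IsSeparationCurve Ω Cs γ ∧
        ∀ B, SepJohn.IsSeparatingBallOf Ω Cs γ B →
          volume (SepJohn.ballEnd Ω x₀ B) ≤ ENNReal.ofReal CE * volume B := by
    intro CE h x hx
    obtain ⟨γ, hγ⟩ := hsep.2 x hx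
    exact ⟨γ, hγ, fun B hB => h B ⟨x, hx, γ, hγ, hB⟩⟩
  have john_of_one : ∀ CE : ℝ, 0 < CE → (∀ x ∈ Ω, ∃ γ : Path x x₀,
      SepJohn.IsSeparationCurve Ω Cs γ ∧ ∀ B, SepJohn.IsSeparatingBallOf Ω Cs γ B →
        volume (SepJohn.ballEnd Ω x₀ B) ≤ ENNReal.ofReal CE * volume B) →
      SepJohn.IsJohnDomain Ω := fun CE hCE h =>
    SepJohn.isJohnDomain_of_hasSmallEnds (by omega) hΩ hsep.1 hCE h
  refine ⟨⟨all_of_john, fun ⟨CE, hCE, h⟩ => john_of_one CE hCE (one_of_all CE h)⟩,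
    ⟨fun hJ => ?_, fun ⟨CE, hCE, h⟩ => john_of_one CE hCE h⟩⟩
  obtain ⟨CE, hCE, h⟩ := all_of_john hJ
  exact ⟨CE, hCE, one_of_all CE h⟩
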